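/- Let $\mathbb{D}$ be the open unit disk and $H^2$ the Hardy space of analytic functions $f(z)=\sum_{n\ge 0} a_n z^n$ on $\mathbb{D}$ with $\|f\|^2=\sum_{n\ge 0}|a_n|^2<\infty$. Let $\varphi$ be an analytic self-map of $\mathbb{D}$ with Denjoy–Wolff point $a\in\mathbb{D}$ (that is, the iterates of $\varphi$ converge to $a$ uniformly on compact subsets of $\mathbb{D}$), let $\psi\in H^\infty$ be a bounded analytic function on $\mathbb{D}$, and let $W_{\psi,\varphi}$ be the bounded operator on $H^2$ given by $W_{\psi,\varphi}f=\psi\cdot(f\circ\varphi)$. Suppose that $W_{\psi,\varphi}$ is power-compact, i.e. $W_{\psi,\varphi}^n$ is compact for some positive integer $n$. Then the spectral radius of $W_{\psi,\varphi}$ is $\rho(W_{\psi,\varphi})=|\psi(a)|$, and $W_{\psi,\varphi}$ is normaloid, i.e. $\|W_{\psi,\varphi}\|=\rho(W_{\psi,\varphi})$, if and only if $$\psi=\psi(a)\,\frac{K_a}{K_a\circ\varphi}\quad\text{on }\mathbb{D},$$ where $K_a(z)=\dfrac{1}{1-\overline{a}z}$ is the reproducing kernel of $H^2$ at $a$. 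-/

import Mathlib

noncomputable section

/-- The Hardy space `H²` of the unit disc. Its elements are the analytic functions
`f(z) = ∑ aₙ zⁿ` with `∑ |aₙ|² < ∞`, and `‖f‖² = ∑ |aₙ|²`. The function `f` is recorded by
its sequence of Taylor coefficients; its values on the disc are given by `HardyTwo.eval`. -/
abbrev HardyTwo : Type := lp (fun _ : ℕ => ℂ) 2

/-- The value at `z` (with `|z| < 1`) of the function `∑ aₙ zⁿ` in `H²`. -/
def HardyTwo.eval (f : HardyTwo) (z : ℂ) : ℂ := ∑' n : ℕ, f n * z ^ n

/-- `φ` restricts to an analytic self-map of the open unit disc. -/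
structure IsAnalyticSelfMap (φ : ℂ → ℂ) : Prop where
  differentiableOn : DifferentiableOn ℂ φ (Metric.ball 0 1)
  mapsTo : Set.MapsTo φ (Metric.ball 0 1) (Metric.ball 0 1)

/-- `ψ` restricts to a bounded analytic function on the open unit disc. -/
structure IsHInfty (ψ : ℂ → ℂ) : Prop where
  differentiableOn : DifferentiableOn ℂ ψ (Metric.ball 0 1)
  bounded : ∃ M : ℝ, ∀ z ∈ Metric.ball (0 : ℂ) 1, ‖ψ z‖ ≤ M

/-- `a` is the Denjoy–Wolff point of the self-map `φ` of the disc: the iterates of `φ` converge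
to `a`, uniformly on compact subsets of the disc. -/
def IsDenjoyWolffPoint (φ : ℂ → ℂ) (a : ℂ) : Prop :=
  TendstoLocallyUniformlyOn (fun n : ℕ => φ^[n]) (fun _ => a) Filter.atTop (Metric.ball 0 1)

/-- The reproducing kernel `K_a(z) = 1 / (1 - ā z)` of `H²` at the point `a` of the disc. -/
def szegoKernel (a z : ℂ) : ℂ := 1 / (1 - (starRingEnd ℂ) a * z)

/-- An operator is power-compact if some positive power of it is compact. -/
def IsPowerCompact {E : Type*} [NormedAddCommGroup E] [NormedSpace ℂ E] (T : E →L[ℂ] E) : Prop :=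
  ∃ n : ℕ, 0 < n ∧ IsCompactOperator (T ^ n)

/-- An operator is normaloid if its norm equals its spectral radius. -/
def IsNormaloid {E : Type*} [NormedAddCommGroup E] [NormedSpace ℂ E] (T : E →L[ℂ] E) : Prop :=
  ENNReal.ofReal ‖T‖ = spectralRadius ℂ T

namespace HardyTwo

theorem hasSum_sq (f : HardyTwo) : HasSum (fun n => ‖f n‖ ^ 2) (‖f‖ ^ 2) := by
  have := lp.hasSum_norm (p := 2) (by norm_num) f
  simpa using this

theorem exists_of_sum_le {c : ℕ → ℂ} {C : ℝ} (hC : 0 ≤ C)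
    (h : ∀ s : Finset ℕ, ∑ n ∈ s, ‖c n‖ ^ 2 ≤ C ^ 2) :
    ∃ f : HardyTwo, (∀ n, f n = c n) ∧ ‖f‖ ≤ C := by
  have hm : Memℓp c 2 := memℓp_gen' (C := C ^ 2) (by simpa using h)
  refine ⟨⟨c, hm⟩, fun n => rfl, ?_⟩
  exact lp.norm_le_of_forall_sum_le (by norm_num) hC (by simpa using h)

/-- The reproducing kernel as a vector of `H²`. -/
theorem exists_kernel {a : ℂ} (ha : ‖a‖ < 1) :
    ∃ k : HardyTwo, ∀ n, k n = (starRingEnd ℂ) a ^ n := by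
  have hs : Summable (fun n : ℕ => ‖a‖ ^ (2 * n)) := by
    simp_rw [pow_mul]
    exact summable_geometric_of_lt_one (by positivity) (by nlinarith [norm_nonneg a])
  have hm : Memℓp (fun n : ℕ => (starRingEnd ℂ) a ^ n) 2 := by
    refine memℓp_gen ?_
    simpa [← pow_mul, mul_comm] using hs
  exact ⟨⟨_, hm⟩, fun n => rfl⟩

theorem hasSum_eval (f : HardyTwo) {z : ℂ} (hz : ‖z‖ < 1) :
    HasSum (fun n => f n * z ^ n) (f.eval z) := by
  obtain ⟨k, hk⟩ := exists_kernel hz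
  have := (lp.hasSum_inner (𝕜 := ℂ) k f).summable
  refine Summable.hasSum ?_
  simpa [hk] using this

/-- Point evaluation on `H²` is inner product with the reproducing kernel. -/
theorem exists_reproducing {a : ℂ} (ha : ‖a‖ < 1) :
    ∃ k : HardyTwo, (∀ z : ℂ, ‖z‖ < 1 → k.eval z = szegoKernel a z) ∧
      ∀ f : HardyTwo, inner ℂ k f = f.eval a := by
  obtain ⟨k, hk⟩ := exists_kernel ha
  refine ⟨k, fun z hz => ?_, fun f => ?_⟩
  · have hlt : ‖(starRingEnd ℂ) a * z‖ < 1 := by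
      rw [norm_mul, RCLike.norm_conj]
      nlinarith [norm_nonneg a, norm_nonneg z]
    have := tsum_geometric_of_norm_lt_one hlt
    rw [szegoKernel, one_div, ← this]
    simp [eval, hk, mul_pow]
  · refine (lp.hasSum_inner (𝕜 := ℂ) k f).unique ?_
    simpa [hk] using hasSum_eval f ha

theorem eval_add (f g : HardyTwo) {z : ℂ} (hz : ‖z‖ < 1) :
    (f + g).eval z = f.eval z + g.eval z := by
  obtain ⟨k, -, hk⟩ := exists_reproducing hz
  simp [← hk]

theorem eval_smul (c : ℂ) (f : HardyTwo) {z : ℂ} (hz : ‖z‖ < 1) :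
    (c • f).eval z = c * f.eval z := by
  obtain ⟨k, -, hk⟩ := exists_reproducing hz
  simp [← hk]

theorem eval_sum (s : Finset ℕ) (f : ℕ → HardyTwo) {z : ℂ} (hz : ‖z‖ < 1) :
    (∑ i ∈ s, f i).eval z = ∑ i ∈ s, (f i).eval z := by
  obtain ⟨k, -, hk⟩ := exists_reproducing hz
  simp [← hk]

theorem eval_zero_right (f : HardyTwo) : f.eval 0 = f 0 := by
  rw [eval, tsum_eq_single 0]
  · simp
  · intro n hn
    simp [hn]

/-- Parseval's identity on the circle of radius `r < 1`. -/
theorem parseval {c : ℕ → ℂ} {F : ℂ → ℂ}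
    (hF : ∀ z : ℂ, ‖z‖ < 1 → HasSum (fun n => c n * z ^ n) (F z)) {r : ℝ} (h0 : 0 ≤ r)
    (h1 : r < 1) :
    ∃ u : MeasureTheory.Lp ℂ 2 (AddCircle.haarAddCircle (T := 1)),
      (∀ᵐ t ∂(AddCircle.haarAddCircle (T := 1)), u t = F (r * (AddCircle.toCircle t : ℂ))) ∧
      HasSum (fun n => ‖c n‖ ^ 2 * (r ^ n) ^ 2) (‖u‖ ^ 2) := by
  have hnorm : ∀ t : AddCircle (1 : ℝ), ‖(r : ℂ) * (AddCircle.toCircle t : ℂ)‖ < 1 := by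
    intro t
    rw [norm_mul, Circle.norm_coe, mul_one, Complex.norm_real, Real.norm_of_nonneg h0]
    exact h1
  have hsum : Summable (fun n : ℕ => (c n * (r : ℂ) ^ n) • (fourier (T := 1) (n : ℤ))) := by
    refine Summable.of_norm ?_
    have := (hF r (by simpa [abs_of_nonneg h0] using h1)).summable.norm
    simpa [norm_smul, fourier_norm] using this
  obtain ⟨G, hG⟩ := hsum
  have hGt : ∀ t, G t = F (r * (AddCircle.toCircle t : ℂ)) := by
    intro t
    have h := hG.mapL (ContinuousMap.evalCLM ℂ t)
    refine HasSum.unique h ?_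
    have h' := hF _ (hnorm t)
    refine h'.congr_fun ?_ |> id
    intro n
    simp [fourier_apply, AddCircle.toCircle_nsmul, mul_pow, mul_assoc]
  have hL := hG.mapL (ContinuousMap.toLp (E := ℂ) 2 (AddCircle.haarAddCircle (T := 1)) ℂ)
  refine ⟨ContinuousMap.toLp (E := ℂ) 2 (AddCircle.haarAddCircle (T := 1)) ℂ G, ?_, ?_⟩
  · filter_upwards [ContinuousMap.coeFn_toLp (AddCircle.haarAddCircle (T := 1)) (𝕜 := ℂ) (p := 2) G]
      with t ht
    rw [ht, hGt]
  · have hon : Orthonormal ℂ (fun n : ℕ => fourierLp (T := 1) 2 (n : ℤ)) :=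
      (orthonormal_fourier (T := 1)).comp _ Nat.cast_injective
    have hlim := (hL.norm).pow 2
    refine Filter.Tendsto.congr (fun s => ?_) hlim
    have := hon.inner_sum (fun n => c n * (r : ℂ) ^ n) (fun n => c n * (r : ℂ) ^ n) s
    have h2 : ∑ n ∈ s, (starRingEnd ℂ) (c n * (r : ℂ) ^ n) * (c n * (r : ℂ) ^ n) =
        ((∑ n ∈ s, ‖c n‖ ^ 2 * (r ^ n) ^ 2 : ℝ) : ℂ) := by
      push_cast
      refine Finset.sum_congr rfl fun n _ => ?_
      rw [Complex.conj_mul', norm_mul, norm_pow, Complex.norm_real, Real.norm_of_nonneg h0]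
      push_cast
      ring
    rw [h2] at this
    have h3 : (∑ n ∈ s, (ContinuousMap.toLp (E := ℂ) 2 (AddCircle.haarAddCircle (T := 1)) ℂ)
        ((c n * (r : ℂ) ^ n) • fourier (T := 1) (n : ℤ))) =
        ∑ n ∈ s, (c n * (r : ℂ) ^ n) • fourierLp (T := 1) 2 (n : ℤ) := by
      simp [fourierLp]
    rw [h3, ← inner_self_eq_norm_sq (𝕜 := ℂ), this]
    exact (Complex.ofReal_re _).symm

theorem eq_zero_of_eval {f : HardyTwo} (h : ∀ z : ℂ, ‖z‖ < 1 → f.eval z = 0) : f = 0 := by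
  have hF : ∀ z : ℂ, ‖z‖ < 1 → HasSum (fun n => f n * z ^ n) ((fun _ => (0 : ℂ)) z) := by
    intro z hz
    simpa [h z hz] using hasSum_eval f hz
  obtain ⟨u, hu, hs⟩ := parseval hF (r := 1 / 2) (by norm_num) (by norm_num)
  have hu0 : u = 0 := by
    rw [MeasureTheory.Lp.eq_zero_iff_ae_eq_zero]
    exact hu
  rw [hu0] at hs
  have h0 : (fun n => ‖f n‖ ^ 2 * (((1 / 2 : ℝ)) ^ n) ^ 2) = 0 := by
    refine (hasSum_zero_iff_of_nonneg (fun n => ?_)).1 (by simpa using hs)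
    positivity
  ext n
  have := congrFun h0 n
  simpa using this

theorem ext_eval {f g : HardyTwo} (h : ∀ z : ℂ, ‖z‖ < 1 → f.eval z = g.eval z) : f = g := by
  rw [← sub_eq_zero]
  refine eq_zero_of_eval fun z hz => ?_
  have : f - g = f + (-1 : ℂ) • g := by simp [sub_eq_add_neg]
  rw [this, eval_add _ _ hz, eval_smul _ _ hz, h z hz]
  ring

/-- A bounded analytic function multiplies `H²` into itself, with norm at most its sup norm. -/
theorem exists_mul {g : ℂ → ℂ} (hg : DifferentiableOn ℂ g (Metric.ball 0 1)) {M : ℝ}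
    (hM : ∀ z ∈ Metric.ball (0 : ℂ) 1, ‖g z‖ ≤ M) (f : HardyTwo) :
    ∃ h : HardyTwo, (∀ z : ℂ, ‖z‖ < 1 → h.eval z = g z * f.eval z) ∧ ‖h‖ ≤ M * ‖f‖ := by
  have hM0 : 0 ≤ M := (norm_nonneg _).trans (hM 0 (by simp))
  obtain ⟨b, hb⟩ : ∃ b : ℕ → ℂ, ∀ z : ℂ, ‖z‖ < 1 → HasSum (fun n => b n * z ^ n) (g z) := by
    refine ⟨fun n => (n.factorial : ℂ)⁻¹ * iteratedDeriv n g 0, fun z hz => ?_⟩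
    have := Complex.hasSum_taylorSeries_on_ball (r := 1) (c := 0) (f := g) (by simpa using hg)
      (z := z) (by simpa using hz)
    simpa [mul_comm, mul_left_comm] using this
  set c : ℕ → ℂ := fun n => ∑ kl ∈ Finset.HasAntidiagonal.antidiagonal n, b kl.1 * f kl.2 with hc
  have hcs : ∀ z : ℂ, ‖z‖ < 1 → HasSum (fun n => c n * z ^ n) (g z * f.eval z) := by
    intro z hz
    have h1 := (hb z hz).summable.norm
    have h2 := (hasSum_eval f hz).summable.norm
    have h3 := tsum_mul_tsum_eq_tsum_sum_antidiagonal_of_summable_norm h1 h2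
    have h4 := (summable_norm_sum_mul_antidiagonal_of_summable_norm h1 h2).of_norm.hasSum
    rw [← h3, (hb z hz).tsum_eq, (hasSum_eval f hz).tsum_eq] at h4
    refine h4.congr_fun fun n => ?_
    simp only [hc, Finset.sum_mul]
    refine Finset.sum_congr rfl fun kl hkl => ?_
    rw [← Finset.HasAntidiagonal.mem_antidiagonal.1 hkl, pow_add]
    ring
  have key : ∀ r : ℝ, 0 ≤ r → r < 1 → ∀ s : Finset ℕ,
      ∑ n ∈ s, ‖c n‖ ^ 2 * (r ^ n) ^ 2 ≤ (M * ‖f‖) ^ 2 := by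
    intro r h0 h1 s
    obtain ⟨u, hu, hus⟩ := parseval hcs h0 h1
    obtain ⟨v, hv, hvs⟩ := parseval (fun z hz => hasSum_eval f hz) h0 h1
    have huv : ‖u‖ ≤ M * ‖v‖ := by
      refine MeasureTheory.Lp.norm_le_mul_norm_of_ae_le_mul ?_
      filter_upwards [hu, hv] with t ht1 ht2
      rw [ht1, ht2, norm_mul]
      refine mul_le_mul_of_nonneg_right (hM _ ?_) (norm_nonneg _)
      rw [mem_ball_zero_iff, norm_mul, Circle.norm_coe, mul_one, Complex.norm_real,
        Real.norm_of_nonneg h0]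
      exact h1
    have hvf : ‖v‖ ≤ ‖f‖ := by
      refine le_of_sq_le_sq ?_ (norm_nonneg _)
      refine hasSum_le (fun n => ?_) hvs (hasSum_sq f)
      have : (r ^ n) ^ 2 ≤ 1 := pow_le_one₀ (by positivity) (pow_le_one₀ h0 h1.le)
      nlinarith [sq_nonneg ‖f n‖]
    have h5 : ‖u‖ ≤ M * ‖f‖ := huv.trans (by gcongr)
    calc _ ≤ ‖u‖ ^ 2 := sum_le_hasSum s (fun n _ => by positivity) hus
      _ ≤ _ := by gcongr
  obtain ⟨h, hh, hn⟩ := exists_of_sum_le (c := c) (C := M * ‖f‖) (by positivity) (by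
    intro s
    have ht : Filter.Tendsto (fun r : ℝ => ∑ n ∈ s, ‖c n‖ ^ 2 * (r ^ n) ^ 2)
        (nhdsWithin 1 (Set.Iio 1)) (nhds (∑ n ∈ s, ‖c n‖ ^ 2)) := by
      have : Continuous (fun r : ℝ => ∑ n ∈ s, ‖c n‖ ^ 2 * (r ^ n) ^ 2) := by fun_prop
      have := (this.tendsto 1).mono_left (nhdsWithin_le_nhds (s := Set.Iio 1))
      simpa using this
    refine le_of_tendsto ht ?_
    filter_upwards [Ioo_mem_nhdsLT (zero_lt_one' ℝ)] with r hr
    exact key r hr.1.le hr.2 s)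
  refine ⟨h, fun z hz => ?_, hn⟩
  refine (hasSum_eval h hz).unique ?_
  simpa [hh] using hcs z hz

/-- Composition of polynomials with `φ`, with a norm bound through the backward shifts. -/
theorem exists_poly_comp {φ : ℂ → ℂ} (hφ : IsAnalyticSelfMap φ) (N : ℕ) :
    ∀ a : ℕ → ℂ, ∃ h : HardyTwo,
      (∀ z : ℂ, ‖z‖ < 1 → h.eval z = ∑ i ∈ Finset.range N, a i * φ z ^ i) ∧
      ‖h‖ ^ 2 ≤ ∑ k ∈ Finset.range N, ‖∑ j ∈ Finset.range (N - k), a (k + j) * φ 0 ^ j‖ ^ 2 := by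
  induction N with
  | zero =>
    intro a
    exact ⟨0, fun z _ => by simp [eval], by simp⟩
  | succ N ih =>
    intro a
    obtain ⟨q, hq, hqn⟩ := ih (fun i => a (i + 1))
    obtain ⟨g, hg, hgn⟩ := exists_mul hφ.differentiableOn (M := 1)
      (fun z hz => (mem_ball_zero_iff.1 (hφ.mapsTo hz)).le) q
    rw [one_mul] at hgn
    obtain ⟨e, he, hei⟩ := exists_reproducing (a := 0) (by simp)
    have he1 : ∀ z : ℂ, ‖z‖ < 1 → e.eval z = 1 := fun z hz => by simp [he z hz, szegoKernel]
    have hee : inner ℂ e e = (1 : ℂ) := by rw [hei, he1 0 (by simp)]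
    have hen : ‖e‖ ^ 2 = 1 := by
      rw [← inner_self_eq_norm_sq (𝕜 := ℂ), hee]
      simp
    refine ⟨a 0 • e + g, fun z hz => ?_, ?_⟩
    · rw [eval_add _ _ hz, eval_smul _ _ hz, he1 z hz, hg z hz, hq z hz, Finset.sum_range_succ',
        Finset.mul_sum, add_comm]
      simp only [pow_zero]
      congr 1
      refine Finset.sum_congr rfl fun i _ => ?_
      ring
    · have hg0 : g.eval 0 = φ 0 * ∑ i ∈ Finset.range N, a (i + 1) * φ 0 ^ i := by
        rw [hg 0 (by simp), hq 0 (by simp)]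
      have hp : ∑ j ∈ Finset.range (N + 1), a (0 + j) * φ 0 ^ j = a 0 + g.eval 0 := by
        rw [Finset.sum_range_succ', hg0, Finset.mul_sum, add_comm]
        simp only [pow_zero, zero_add, mul_one]
        congr 1
        refine Finset.sum_congr rfl fun i _ => ?_
        ring
      have hn : ‖a 0 • e + g‖ ^ 2 = ‖a 0 + g.eval 0‖ ^ 2 - ‖g.eval 0‖ ^ 2 + ‖g‖ ^ 2 := by
        rw [norm_add_sq (𝕜 := ℂ), norm_add_sq (𝕜 := ℂ), inner_smul_left, hei, norm_smul, mul_pow,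
          hen]
        simp only [RCLike.inner_apply]
        ring_nf
      rw [Finset.sum_range_succ', Nat.sub_zero, hp, hn]
      have hr : ∑ k ∈ Finset.range N,
          ‖∑ j ∈ Finset.range (N + 1 - (k + 1)), a (k + 1 + j) * φ 0 ^ j‖ ^ 2 =
          ∑ k ∈ Finset.range N, ‖∑ j ∈ Finset.range (N - k), a (k + j + 1) * φ 0 ^ j‖ ^ 2 := by
        refine Finset.sum_congr rfl fun k _ => ?_
        rw [Nat.add_sub_add_right]
        simp only [add_right_comm]
      rw [hr]
      have h1 : ‖g‖ ^ 2 ≤ ‖q‖ ^ 2 := by gcongr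
      have h2 := sq_nonneg ‖g.eval 0‖
      linarith

theorem sum_shift_le (a : ℕ → ℂ) {b : ℂ} (hb : ‖b‖ < 1) (N : ℕ) :
    ∑ k ∈ Finset.range N, ‖∑ j ∈ Finset.range (N - k), a (k + j) * b ^ j‖ ^ 2 ≤
      ((1 - ‖b‖)⁻¹) ^ 2 * ∑ i ∈ Finset.range N, ‖a i‖ ^ 2 := by
  have hgeo : ∀ n : ℕ, ∑ j ∈ Finset.range n, ‖b‖ ^ j ≤ (1 - ‖b‖)⁻¹ := fun n =>
    sum_le_hasSum _ (fun j _ => by positivity) (hasSum_geometric_of_lt_one (norm_nonneg b) hb)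
  have hpos : 0 ≤ (1 - ‖b‖)⁻¹ := inv_nonneg.2 (by linarith)
  have hk : ∀ k ∈ Finset.range N, ‖∑ j ∈ Finset.range (N - k), a (k + j) * b ^ j‖ ^ 2 ≤
      (1 - ‖b‖)⁻¹ * ∑ j ∈ Finset.range (N - k), ‖b‖ ^ j * ‖a (k + j)‖ ^ 2 := by
    intro k _
    have h1 : ‖∑ j ∈ Finset.range (N - k), a (k + j) * b ^ j‖ ≤
        ∑ j ∈ Finset.range (N - k), ‖b‖ ^ j * ‖a (k + j)‖ := by
      refine (norm_sum_le _ _).trans (Finset.sum_le_sum fun j _ => ?_)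
      rw [norm_mul, norm_pow, mul_comm]
    have h2 : (∑ j ∈ Finset.range (N - k), ‖b‖ ^ j * ‖a (k + j)‖) ^ 2 ≤
        (∑ j ∈ Finset.range (N - k), ‖b‖ ^ j) *
          ∑ j ∈ Finset.range (N - k), ‖b‖ ^ j * ‖a (k + j)‖ ^ 2 := by
      refine Finset.sum_sq_le_sum_mul_sum_of_sq_le_mul _ (fun _ _ => by positivity)
        (fun _ _ => by positivity) (fun _ _ => le_of_eq (by ring))
    calc _ ≤ (∑ j ∈ Finset.range (N - k), ‖b‖ ^ j * ‖a (k + j)‖) ^ 2 := by gcongr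
      _ ≤ _ := h2
      _ ≤ _ := by
        gcongr
        exact hgeo _
  have hswap : ∑ k ∈ Finset.range N, ∑ j ∈ Finset.range (N - k), ‖b‖ ^ j * ‖a (k + j)‖ ^ 2 =
      ∑ j ∈ Finset.range N, ∑ k ∈ Finset.range (N - j), ‖b‖ ^ j * ‖a (k + j)‖ ^ 2 := by
    refine Finset.sum_comm' fun k j => ?_
    simp only [Finset.mem_range]
    omega
  have hin : ∀ j ∈ Finset.range N, ∑ k ∈ Finset.range (N - j), ‖b‖ ^ j * ‖a (k + j)‖ ^ 2 ≤
      ‖b‖ ^ j * ∑ i ∈ Finset.range N, ‖a i‖ ^ 2 := by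
    intro j _
    rw [← Finset.mul_sum]
    gcongr
    have := Finset.sum_Ico_eq_sum_range (fun i => ‖a i‖ ^ 2) j N
    simp only [add_comm j] at this
    rw [← this]
    refine Finset.sum_le_sum_of_subset_of_nonneg (fun i hi => ?_) (fun _ _ _ => by positivity)
    simp only [Finset.mem_Ico, Finset.mem_range] at hi ⊢
    exact hi.2
  calc _ ≤ ∑ k ∈ Finset.range N,
        (1 - ‖b‖)⁻¹ * ∑ j ∈ Finset.range (N - k), ‖b‖ ^ j * ‖a (k + j)‖ ^ 2 :=
        Finset.sum_le_sum hk
    _ = (1 - ‖b‖)⁻¹ *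
        ∑ j ∈ Finset.range N, ∑ k ∈ Finset.range (N - j), ‖b‖ ^ j * ‖a (k + j)‖ ^ 2 := by
        rw [← Finset.mul_sum, hswap]
    _ ≤ (1 - ‖b‖)⁻¹ * ((1 - ‖b‖)⁻¹ * ∑ i ∈ Finset.range N, ‖a i‖ ^ 2) := by
        gcongr
        refine (Finset.sum_le_sum hin).trans ?_
        rw [← Finset.sum_mul]
        gcongr
        exact hgeo N
    _ = _ := by ring

/-- Composition with an analytic self-map of the disc is bounded on `H²`. -/
theorem exists_comp {φ : ℂ → ℂ} (hφ : IsAnalyticSelfMap φ) (f : HardyTwo) :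
    ∃ h : HardyTwo, (∀ z : ℂ, ‖z‖ < 1 → h.eval z = f.eval (φ z)) ∧
      ‖h‖ ≤ (1 - ‖φ 0‖)⁻¹ * ‖f‖ := by
  have hb : ‖φ 0‖ < 1 := mem_ball_zero_iff.1 (hφ.mapsTo (by simp))
  set C : ℝ := (1 - ‖φ 0‖)⁻¹ with hC
  have hCpos : 0 < C := inv_pos.2 (by linarith)
  have hpoly : ∀ (N : ℕ) (a : ℕ → ℂ), ∃ h : HardyTwo,
      (∀ z : ℂ, ‖z‖ < 1 → h.eval z = ∑ i ∈ Finset.range N, a i * φ z ^ i) ∧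
      ‖h‖ ^ 2 ≤ C ^ 2 * ∑ i ∈ Finset.range N, ‖a i‖ ^ 2 := by
    intro N a
    obtain ⟨h, h1, h2⟩ := exists_poly_comp hφ N a
    exact ⟨h, h1, h2.trans (sum_shift_le a hb N)⟩
  have hv : ∀ n : ℕ, ∃ v : HardyTwo, ∀ z : ℂ, ‖z‖ < 1 → v.eval z = φ z ^ n := by
    intro n
    obtain ⟨h, h1, -⟩ := hpoly (n + 1) (Pi.single n 1)
    refine ⟨h, fun z hz => ?_⟩
    rw [h1 z hz, Finset.sum_eq_single n]
    · simp
    · intro i _ hi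
      simp [hi]
    · simp
  choose v hv using hv
  have hs : ∀ s : Finset ℕ, ‖∑ i ∈ s, f i • v i‖ ^ 2 ≤ C ^ 2 * ∑ i ∈ s, ‖f i‖ ^ 2 := by
    intro s
    obtain ⟨N, hN⟩ := s.exists_nat_subset_range
    obtain ⟨h, h1, h2⟩ := hpoly N (fun i => if i ∈ s then f i else 0)
    have hh : ∑ i ∈ s, f i • v i = h := by
      refine ext_eval fun z hz => ?_
      rw [eval_sum _ _ hz, h1 z hz]
      simp only [ite_mul, zero_mul, Finset.sum_ite_mem, Finset.inter_eq_right.2 hN]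
      exact Finset.sum_congr rfl fun i _ => by rw [eval_smul _ _ hz, hv i z hz]
    rw [hh]
    refine h2.trans (le_of_eq ?_)
    congr 1
    rw [← Finset.inter_eq_right.2 hN, ← Finset.sum_ite_mem]
    refine Finset.sum_congr rfl fun i hi => ?_
    rw [Finset.inter_eq_right.2 hN]
    split_ifs <;> simp
  have hsum : Summable (fun i => f i • v i) := by
    rw [summable_iff_vanishing_norm]
    intro ε hε
    obtain ⟨s, hs'⟩ := summable_iff_vanishing_norm.1 (hasSum_sq f).summable ((ε / C) ^ 2)
      (by positivity)
    refine ⟨s, fun t ht => ?_⟩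
    have h1 := (le_abs_self _).trans_lt (hs' t ht)
    have h2 := hs t
    refine lt_of_pow_lt_pow_left₀ 2 hε.le ?_
    calc _ ≤ _ := h2
      _ < C ^ 2 * (ε / C) ^ 2 := by gcongr
      _ = ε ^ 2 := by field_simp
  obtain ⟨h, hh⟩ := hsum
  refine ⟨h, fun z hz => ?_, ?_⟩
  · obtain ⟨k, -, hk⟩ := exists_reproducing hz
    have h1 := hh.mapL (innerSL ℂ k)
    have h2 := hasSum_eval f (mem_ball_zero_iff.1 (hφ.mapsTo (mem_ball_zero_iff.2 hz)))
    rw [← hk]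
    refine HasSum.unique h1 ?_
    refine h2.congr_fun fun i => ?_
    rw [innerSL_apply_apply, inner_smul_right, hk, hv i z hz]
  · refine le_of_tendsto hh.norm (Filter.Eventually.of_forall fun s => ?_)
    refine le_of_sq_le_sq ?_ (by positivity)
    refine (hs s).trans ?_
    rw [mul_pow]
    gcongr
    exact sum_le_hasSum s (fun i _ => by positivity) (hasSum_sq f)

/-- For `ψ ∈ H^∞` and `φ` an analytic self-map of the disc, `f ↦ ψ · (f ∘ φ)` is a bounded
operator on `H²`. -/
theorem exists_weightedComp {ψ φ : ℂ → ℂ} (hψ : IsHInfty ψ) (hφ : IsAnalyticSelfMap φ) :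
    ∃ W : HardyTwo →L[ℂ] HardyTwo, ∀ (f : HardyTwo), ∀ z ∈ Metric.ball (0 : ℂ) 1,
      (W f).eval z = ψ z * f.eval (φ z) := by
  obtain ⟨M, hM⟩ := hψ.bounded
  have hM0 : 0 ≤ M := (norm_nonneg _).trans (hM 0 (by simp))
  have key : ∀ f : HardyTwo, ∃ h : HardyTwo,
      (∀ z : ℂ, ‖z‖ < 1 → h.eval z = ψ z * f.eval (φ z)) ∧
        ‖h‖ ≤ (M * (1 - ‖φ 0‖)⁻¹) * ‖f‖ := by
    intro f
    obtain ⟨h, h1, h2⟩ := exists_comp hφ f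
    obtain ⟨g, g1, g2⟩ := exists_mul hψ.differentiableOn hM h
    refine ⟨g, fun z hz => by rw [g1 z hz, h1 z hz], g2.trans ?_⟩
    rw [mul_assoc]
    gcongr
  choose W hW hWn using key
  have hm : ∀ z : ℂ, ‖z‖ < 1 → ‖φ z‖ < 1 := fun z hz =>
    mem_ball_zero_iff.1 (hφ.mapsTo (mem_ball_zero_iff.2 hz))
  refine ⟨LinearMap.mkContinuous
    { toFun := W
      map_add' := fun f g => ext_eval fun z hz => ?_
      map_smul' := fun c f => ext_eval fun z hz => ?_ } _ hWn, fun f z hz => ?_⟩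
  · rw [eval_add _ _ hz, hW _ z hz, hW _ z hz, hW _ z hz, eval_add _ _ (hm z hz)]
    ring
  · rw [RingHom.id_apply, eval_smul _ _ hz, hW _ z hz, hW _ z hz, eval_smul _ _ (hm z hz)]
    ring
  · exact hW f z (mem_ball_zero_iff.1 hz)

end HardyTwo

/-- The weighted composition operator `W_{ψ,φ} f = ψ · (f ∘ φ)` on `H²`. It is determined by this
identity on the disc, since a function in `H²` is determined by its values there. -/
def weightedComp {ψ φ : ℂ → ℂ} (hψ : IsHInfty ψ) (hφ : IsAnalyticSelfMap φ) :
    HardyTwo →L[ℂ] HardyTwo :=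
  (HardyTwo.exists_weightedComp hψ hφ).choose

theorem weightedComp_eval {ψ φ : ℂ → ℂ} (hψ : IsHInfty ψ) (hφ : IsAnalyticSelfMap φ)
    (f : HardyTwo) {z : ℂ} (hz : z ∈ Metric.ball (0 : ℂ) 1) :
    (weightedComp hψ hφ f).eval z = ψ z * f.eval (φ z) :=
  (HardyTwo.exists_weightedComp hψ hφ).choose_spec f z hz

end

/-! Write W for the operator. Its symbol fixes the Denjoy–Wolff point a, so `⟪K_a, W f⟫ = ψ(a) ⟪K_a,
f⟫` for every f. The range of ψ(a) - W is therefore orthogonal to K_a, which puts ψ(a) in the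
spectrum. Conversely, if l ≠ 0 is in the spectrum, compactness of W^n makes l^n an eigenvalue of
W^n. Iterating the eigenvalue equation along an orbit of φ, which tends to a, compares powers of l
with products of weights close to ψ(a), so |l| ≤ |ψ(a)| (`norm_le_of_weightedComp_pow_apply_eq`).

Normaloid thus means ‖W‖ = |ψ(a)|. In that case the equality case of Cauchy–Schwarz forces W K_a =
ψ(a) K_a, which read pointwise is the formula for ψ (`eq_of_norm_weightedComp_le`). Conversely, the
formula gives W = ψ(a) U C U, where U is an isometric involution built from the disc automorphism τ
exchanging 0 and a, and C is composition with τ ∘ φ ∘ τ. That map fixes 0, so C is a contraction by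
Littlewood subordination, and ‖W‖ ≤ |ψ(a)| (`norm_weightedComp_le`). -/

open Filter Topology

/-! ### Fixed point and iterates of the symbol -/

/-- The Denjoy–Wolff point of a self-map of the disc is fixed, if it lies in the disc. -/
theorem IsDenjoyWolffPoint.map_eq {φ : ℂ → ℂ} {a : ℂ} (hφ : IsAnalyticSelfMap φ)
    (ha : a ∈ Metric.ball (0 : ℂ) 1) (hDW : IsDenjoyWolffPoint φ a) : φ a = a := by
  have h := TendstoLocallyUniformlyOn.tendsto_at hDW ha
  have hc : ContinuousAt φ a :=
    (hφ.differentiableOn.differentiableAt (Metric.isOpen_ball.mem_nhds ha)).continuousAt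
  have h1 : Tendsto (fun n : ℕ => φ^[n + 1] a) atTop (𝓝 (φ a)) := by
    simp only [Function.iterate_succ_apply']
    exact hc.tendsto.comp h
  exact tendsto_nhds_unique h1 (h.comp (tendsto_add_atTop_nat 1))

theorem IsAnalyticSelfMap.norm_lt {φ : ℂ → ℂ} (hφ : IsAnalyticSelfMap φ) {z : ℂ} (hz : ‖z‖ < 1) :
    ‖φ z‖ < 1 :=
  mem_ball_zero_iff.1 (hφ.mapsTo (mem_ball_zero_iff.2 hz))

theorem IsAnalyticSelfMap.norm_iterate_lt {φ : ℂ → ℂ} (hφ : IsAnalyticSelfMap φ) {z : ℂ}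
    (hz : ‖z‖ < 1) (n : ℕ) : ‖φ^[n] z‖ < 1 :=
  mem_ball_zero_iff.1 (hφ.mapsTo.iterate n (mem_ball_zero_iff.2 hz))

theorem IsAnalyticSelfMap.comp {φ χ : ℂ → ℂ} (hφ : IsAnalyticSelfMap φ)
    (hχ : IsAnalyticSelfMap χ) : IsAnalyticSelfMap (φ ∘ χ) :=
  ⟨hφ.differentiableOn.comp hχ.differentiableOn hχ.mapsTo, hφ.mapsTo.comp hχ.mapsTo⟩

/-- Functions in `H²` are bounded on smaller concentric discs. -/
theorem HardyTwo.exists_bound_eval (f : HardyTwo) {r : ℝ} (h0 : 0 ≤ r) (h1 : r < 1) :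
    ∃ B : ℝ, ∀ z : ℂ, ‖z‖ ≤ r → ‖f.eval z‖ ≤ B := by
  have hr := (f.hasSum_eval (z := r) (by simpa [abs_of_nonneg h0] using h1)).summable.norm
  refine ⟨∑' n, ‖f n * (r : ℂ) ^ n‖, fun z hz => ?_⟩
  refine tsum_of_norm_bounded hr.hasSum fun n => ?_
  rw [norm_mul, norm_mul, norm_pow, norm_pow, Complex.norm_real, Real.norm_of_nonneg h0]
  gcongr

/-! ### Spectral radius -/

section

variable {ψ φ : ℂ → ℂ} {a : ℂ} (hψ : IsHInfty ψ) (hφ : IsAnalyticSelfMap φ)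

theorem weightedComp_pow_eval (m : ℕ) (f : HardyTwo) {z : ℂ} (hz : ‖z‖ < 1) :
    ((weightedComp hψ hφ ^ m) f).eval z =
      (∏ j ∈ Finset.range m, ψ (φ^[j] z)) * f.eval (φ^[m] z) := by
  induction m generalizing f with
  | zero => simp
  | succ m ih =>
    rw [pow_succ, mul_apply_eq_comp, ih,
      weightedComp_eval hψ hφ f (mem_ball_zero_iff.2 (hφ.norm_iterate_lt hz m)),
      Finset.prod_range_succ, Function.iterate_succ_apply', mul_assoc]

/-- Eigenvalues of powers of a weighted composition operator are controlled by the weight at the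
Denjoy–Wolff point. -/
theorem norm_le_of_weightedComp_pow_apply_eq (ha : ‖a‖ < 1) (hDW : IsDenjoyWolffPoint φ a)
    {n : ℕ} (hn : 0 < n) {μ : ℂ} (hμ : μ ≠ 0) {f : HardyTwo} (hf : f ≠ 0)
    (hfμ : (weightedComp hψ hφ ^ n) f = μ • f) {c : ℝ} (hc : ‖ψ a‖ < c) : ‖μ‖ ≤ c ^ n := by
  have hc0 : 0 < c := (norm_nonneg _).trans_lt hc
  have hpow : ∀ m : ℕ, (weightedComp hψ hφ ^ (n * m)) f = μ ^ m • f := by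
    intro m
    induction m with
    | zero => simp
    | succ m ih =>
      rw [Nat.mul_succ, pow_add, mul_apply_eq_comp, hfμ, map_smul, ih, smul_smul,
        pow_succ']
  obtain ⟨z, hz, hfz⟩ : ∃ z : ℂ, ‖z‖ < 1 ∧ f.eval z ≠ 0 := by
    by_contra! h
    exact hf (HardyTwo.eq_zero_of_eval h)
  have key : ∀ (m : ℕ) (w : ℂ), ‖w‖ < 1 → μ ^ m * f.eval w =
      (∏ j ∈ Finset.range (n * m), ψ (φ^[j] w)) * f.eval (φ^[n * m] w) := by
    intro m w hw
    rw [← weightedComp_pow_eval hψ hφ _ f hw, hpow, HardyTwo.eval_smul _ _ hw]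
  have hlim := TendstoLocallyUniformlyOn.tendsto_at hDW (mem_ball_zero_iff.2 hz)
  obtain ⟨r, har, hr1⟩ := exists_between ha
  have hψc : ContinuousAt ψ a := (hψ.differentiableOn.differentiableAt
    (Metric.isOpen_ball.mem_nhds (mem_ball_zero_iff.2 ha))).continuousAt
  have hev : ∀ᶠ j in atTop, ‖φ^[j] z‖ < r ∧ ‖ψ (φ^[j] z)‖ < c :=
    (hlim.norm.eventually_lt_const har).and
      ((hψc.tendsto.comp hlim).norm.eventually_lt_const hc)
  obtain ⟨J, hJ⟩ := eventually_atTop.1 hev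
  obtain ⟨B, hB⟩ := f.exists_bound_eval ((norm_nonneg a).trans har.le) hr1
  -- Moving the base point along the orbit makes the bounds hold from time 0 on. The exponent is a
  -- multiple of n so that `key` applies, and n * J ≥ J because n > 0.
  set p := φ^[n * J] z with hp
  have hp1 : ‖p‖ < 1 := hφ.norm_iterate_lt hz _
  have horb : ∀ j, ‖φ^[j] p‖ < r ∧ ‖ψ (φ^[j] p)‖ < c := by
    intro j
    rw [hp, ← Function.iterate_add_apply]
    exact hJ _ ((Nat.le_mul_of_pos_left J hn).trans (Nat.le_add_left _ _))
  -- If f vanished at p, the eigenvalue equation iterated J times would give μ^J f(z) = 0.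
  have hfp : f.eval p ≠ 0 := by
    intro h
    have h1 := key J z hz
    rw [← hp, h, mul_zero] at h1
    exact mul_ne_zero (pow_ne_zero _ hμ) hfz h1
  have hbound : ∀ m : ℕ, ‖μ‖ ^ m * ‖f.eval p‖ ≤ (c ^ n) ^ m * B := by
    intro m
    rw [← norm_pow, ← norm_mul, key m p hp1, norm_mul, norm_prod, ← pow_mul]
    refine mul_le_mul ?_ (hB _ (horb _).1.le) (norm_nonneg _) (by positivity)
    refine (Finset.prod_le_prod (fun _ _ => norm_nonneg _) fun j _ => (horb j).2.le).trans ?_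
    simp
  -- Otherwise (‖μ‖ / c^n)^m is unbounded in m, while `hbound` keeps it below B / ‖f(p)‖.
  by_contra! hlt
  have hcn : 0 < c ^ n := by positivity
  obtain ⟨m, hm⟩ := pow_unbounded_of_one_lt (B / ‖f.eval p‖) ((one_lt_div hcn).2 hlt)
  rw [div_pow, div_lt_div_iff₀ (norm_pos_iff.2 hfp) (by positivity)] at hm
  linarith [hbound m]

theorem spectralRadius_weightedComp_le (ha : ‖a‖ < 1) (hDW : IsDenjoyWolffPoint φ a)
    (hpc : IsPowerCompact (weightedComp hψ hφ)) :
    spectralRadius ℂ (weightedComp hψ hφ) ≤ ENNReal.ofReal ‖ψ a‖ := by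
  obtain ⟨n, hn, hcomp⟩ := hpc
  refine iSup₂_le fun l hl => ?_
  rw [← enorm_eq_nnnorm, ← ofReal_norm]
  refine ENNReal.ofReal_le_ofReal ?_
  rcases eq_or_ne l 0 with rfl | hl0
  · simp
  -- The power l^n lies in the spectrum of the compact operator W^n and is nonzero, hence is an
  -- eigenvalue.
  have hev := (hcomp.hasEigenvalue_iff_mem_spectrum (pow_ne_zero n hl0)).2
    (spectrum.pow_mem_pow _ n hl)
  obtain ⟨f, hf⟩ := hev.exists_hasEigenvector
  -- The weights along an orbit are only eventually below each c > ‖ψ a‖, so the bound is obtained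
  -- for every such c.
  refine le_of_forall_gt_imp_ge_of_dense fun c hc => ?_
  have h := norm_le_of_weightedComp_pow_apply_eq hψ hφ ha hDW hn (pow_ne_zero n hl0) hf.2
    hf.apply_eq_smul hc
  rw [norm_pow] at h
  exact le_of_pow_le_pow_left₀ hn.ne' ((norm_nonneg _).trans hc.le) h

/-- The value of the weight at a fixed point of the symbol lies in the spectrum. -/
theorem apply_mem_spectrum_weightedComp (ha : ‖a‖ < 1) (hfix : φ a = a) :
    ψ a ∈ spectrum ℂ (weightedComp hψ hφ) := by
  obtain ⟨k, hk, hki⟩ := HardyTwo.exists_reproducing ha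
  rw [spectrum.mem_iff, ContinuousLinearMap.isUnit_iff_bijective]
  rintro ⟨-, hsurj⟩
  obtain ⟨f, hf⟩ := hsurj k
  -- If ψ(a) - W were onto, k would lie in its range, which is orthogonal to k. But k(0) = 1.
  have h0 : inner ℂ k k = (0 : ℂ) := by
    nth_rw 2 [← hf]
    rw [sub_apply, inner_sub_right, Algebra.algebraMap_eq_smul_one,
      smul_apply, one_apply_eq_self, inner_smul_right, hki, hki,
      weightedComp_eval hψ hφ f (mem_ball_zero_iff.2 ha), hfix, sub_self]
  have h1 := hk 0 (by simp)
  rw [inner_self_eq_zero.1 h0] at h1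
  simp [HardyTwo.eval, szegoKernel] at h1

theorem spectralRadius_weightedComp (ha : ‖a‖ < 1) (hDW : IsDenjoyWolffPoint φ a)
    (hpc : IsPowerCompact (weightedComp hψ hφ)) :
    spectralRadius ℂ (weightedComp hψ hφ) = ENNReal.ofReal ‖ψ a‖ := by
  refine le_antisymm (spectralRadius_weightedComp_le hψ hφ ha hDW hpc) ?_
  rw [ofReal_norm, enorm_eq_nnnorm]
  exact le_iSup₂ (f := fun (l : ℂ) (_ : l ∈ spectrum ℂ (weightedComp hψ hφ)) => (‖l‖₊ : ENNReal)) _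
    (apply_mem_spectrum_weightedComp hψ hφ ha (hDW.map_eq hφ (mem_ball_zero_iff.2 ha)))

end

/-! ### Extremal norm forces the form of the weight -/

/-- If `⟪x, T y⟫ = l ⟪x, y⟫` for all `y`, with `‖T‖ ≤ ‖l‖`, then `T x = l x`. -/
theorem ContinuousLinearMap.apply_eq_smul_of_forall_inner {E : Type*} [NormedAddCommGroup E]
    [InnerProductSpace ℂ E] {T : E →L[ℂ] E} {l : ℂ} {x : E}
    (h : ∀ y, inner ℂ x (T y) = l * inner ℂ x y) (hT : ‖T‖ ≤ ‖l‖) : T x = l • x := by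
  have h1 : ‖T x‖ ≤ ‖l‖ * ‖x‖ := (T.le_opNorm x).trans (by gcongr)
  -- Taking y = x in the hypothesis shows that the cross term is as large as the norm bound on T x
  -- allows, so expanding ‖T x - l x‖² leaves at most 0.
  have h2 : RCLike.re (inner ℂ (T x) (l • x)) = (‖l‖ * ‖x‖) ^ 2 := by
    rw [inner_smul_right, ← inner_conj_symm, h, map_mul (starRingEnd ℂ), inner_conj_symm, ← mul_assoc,
      Complex.mul_conj', inner_self_eq_norm_sq_to_K, mul_pow]
    norm_cast
    exact (RCLike.re_ofReal_mul (K := ℂ) _ _).trans (congrArg _ (RCLike.ofReal_re (K := ℂ) _))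
  have h3 : ‖T x - l • x‖ ^ 2 ≤ 0 := by
    rw [norm_sub_sq (𝕜 := ℂ), h2, norm_smul]
    nlinarith [norm_nonneg (T x)]
  rw [← sub_eq_zero, ← norm_eq_zero]
  exact pow_eq_zero_iff two_ne_zero |>.1 (le_antisymm h3 (sq_nonneg _))

theorem one_sub_conj_mul_ne_zero {a z : ℂ} (ha : ‖a‖ < 1) (hz : ‖z‖ < 1) :
    1 - (starRingEnd ℂ) a * z ≠ 0 := by
  intro h
  have h1 : ‖(starRingEnd ℂ) a * z‖ = 1 := by rw [← sub_eq_zero.1 h, norm_one]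
  rw [norm_mul, RCLike.norm_conj] at h1
  nlinarith [norm_nonneg a, norm_nonneg z]

theorem szegoKernel_ne_zero {a z : ℂ} (ha : ‖a‖ < 1) (hz : ‖z‖ < 1) : szegoKernel a z ≠ 0 :=
  one_div_ne_zero (one_sub_conj_mul_ne_zero ha hz)

/-- A weighted composition operator whose norm is attained by its weight at a fixed point `a` of
the symbol has weight proportional to `K_a / K_a ∘ φ`. -/
theorem eq_of_norm_weightedComp_le {ψ φ : ℂ → ℂ} {a : ℂ} (hψ : IsHInfty ψ)
    (hφ : IsAnalyticSelfMap φ) (ha : ‖a‖ < 1) (hfix : φ a = a)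
    (hW : ‖weightedComp hψ hφ‖ ≤ ‖ψ a‖) {z : ℂ} (hz : ‖z‖ < 1) :
    ψ z = ψ a * (szegoKernel a z / szegoKernel a (φ z)) := by
  obtain ⟨k, hk, hki⟩ := HardyTwo.exists_reproducing ha
  have h : weightedComp hψ hφ k = ψ a • k := by
    refine ContinuousLinearMap.apply_eq_smul_of_forall_inner (fun f => ?_) hW
    rw [hki, hki, weightedComp_eval hψ hφ f (mem_ball_zero_iff.2 ha), hfix]
  have h1 := weightedComp_eval hψ hφ k (mem_ball_zero_iff.2 hz)
  rw [h, HardyTwo.eval_smul _ _ hz, hk z hz, hk _ (hφ.norm_lt hz)] at h1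
  rw [mul_div_assoc', h1, mul_div_assoc, div_self (szegoKernel_ne_zero ha (hφ.norm_lt hz)),
    mul_one]

/-! ### Conjugation moving the fixed point to 0, and the norm bound -/

/-- The involutive automorphism of the disc exchanging `0` and `a`. -/
noncomputable def discInvolution (a z : ℂ) : ℂ := (a - z) / (1 - (starRingEnd ℂ) a * z)

theorem norm_discInvolution_lt {a z : ℂ} (ha : ‖a‖ < 1) (hz : ‖z‖ < 1) : ‖discInvolution a z‖ < 1 := by
  have hne := one_sub_conj_mul_ne_zero ha hz
  rw [discInvolution, norm_div, div_lt_one (norm_pos_iff.2 hne)]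
  refine lt_of_pow_lt_pow_left₀ 2 (norm_nonneg _) ?_
  have ha2 : Complex.normSq a < 1 := by
    rw [Complex.normSq_eq_norm_sq]; nlinarith [norm_nonneg a]
  have hz2 : Complex.normSq z < 1 := by
    rw [Complex.normSq_eq_norm_sq]; nlinarith [norm_nonneg z]
  rw [← Complex.normSq_eq_norm_sq, ← Complex.normSq_eq_norm_sq]
  -- This product (1 - |a|²)(1 - |z|²) equals |1 - āz|² - |a - z|².
  have h := mul_pos (sub_pos.2 ha2) (sub_pos.2 hz2)
  simp only [Complex.normSq_apply, Complex.sub_re, Complex.sub_im, Complex.mul_re, Complex.mul_im,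
    Complex.conj_re, Complex.conj_im, Complex.one_re, Complex.one_im] at h ⊢
  nlinarith [h]

theorem isAnalyticSelfMap_discInvolution {a : ℂ} (ha : ‖a‖ < 1) :
    IsAnalyticSelfMap (discInvolution a) := by
  refine ⟨?_, fun z hz => mem_ball_zero_iff.2 (norm_discInvolution_lt ha (mem_ball_zero_iff.1 hz))⟩
  refine DifferentiableOn.div (by fun_prop) (by fun_prop) fun z hz => ?_
  exact one_sub_conj_mul_ne_zero ha (mem_ball_zero_iff.1 hz)

theorem one_sub_conj_mul_discInvolution {a z : ℂ} (ha : ‖a‖ < 1) (hz : ‖z‖ < 1) :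
    1 - (starRingEnd ℂ) a * discInvolution a z =
      (1 - (starRingEnd ℂ) a * a) / (1 - (starRingEnd ℂ) a * z) := by
  have hne := one_sub_conj_mul_ne_zero ha hz
  rw [discInvolution]
  field_simp
  ring

theorem discInvolution_discInvolution {a z : ℂ} (ha : ‖a‖ < 1) (hz : ‖z‖ < 1) :
    discInvolution a (discInvolution a z) = z := by
  have hne := one_sub_conj_mul_ne_zero ha hz
  have hna := one_sub_conj_mul_ne_zero ha ha
  rw [discInvolution, one_sub_conj_mul_discInvolution ha hz, discInvolution,
    div_eq_iff (div_ne_zero hna hne), mul_div_assoc', eq_div_iff hne, sub_mul,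
    div_mul_cancel₀ _ hne]
  ring

/-- The denominator expands to 1 - āz - v̄a + v̄z, which is Hermitian symmetric in z and v; this is
what makes the isometric involution self-adjoint. -/
theorem szegoKernel_mul_szegoKernel_discInvolution {a z : ℂ} (ha : ‖a‖ < 1) (hz : ‖z‖ < 1)
    (v : ℂ) : szegoKernel a z * szegoKernel v (discInvolution a z) =
      1 / (1 - (starRingEnd ℂ) a * z - (starRingEnd ℂ) v * (a - z)) := by
  have hne := one_sub_conj_mul_ne_zero ha hz
  rw [szegoKernel, szegoKernel, div_mul_div_comm, one_mul, mul_sub, discInvolution, mul_one,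
    mul_div_assoc', mul_div_cancel₀ _ hne]

theorem isHInfty_szegoKernel {a : ℂ} (ha : ‖a‖ < 1) (c : ℂ) :
    IsHInfty (fun z => c * szegoKernel a z) := by
  refine ⟨?_, ‖c‖ * (1 - ‖a‖)⁻¹, fun z hz => ?_⟩
  · refine DifferentiableOn.const_mul (DifferentiableOn.div (by fun_prop) (by fun_prop)
      fun z hz => ?_) c
    exact one_sub_conj_mul_ne_zero ha (mem_ball_zero_iff.1 hz)
  · rw [norm_mul, szegoKernel, one_div, norm_inv]
    have hz1 := mem_ball_zero_iff.1 hz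
    have h1 : 1 - ‖a‖ ≤ ‖1 - (starRingEnd ℂ) a * z‖ := by
      have := norm_sub_norm_le (1 : ℂ) ((starRingEnd ℂ) a * z)
      rw [norm_one, norm_mul, RCLike.norm_conj] at this
      nlinarith [norm_nonneg a]
    have h2 : 0 < 1 - ‖a‖ := by linarith
    gcongr

/-- The operator `f ↦ s K_a · (f ∘ τ_a)`, with `s² = 1 - |a|²` and `τ_a` the involution of the disc
exchanging `0` and `a`, is an isometric involution of `H²`. -/
theorem exists_isometric_involution {a : ℂ} (ha : ‖a‖ < 1) : ∃ (s : ℝ) (U : HardyTwo →L[ℂ] HardyTwo),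
    (s : ℂ) ^ 2 = 1 - (starRingEnd ℂ) a * a ∧
    (∀ (f : HardyTwo) (z : ℂ), ‖z‖ < 1 →
      (U f).eval z = s * szegoKernel a z * f.eval (discInvolution a z)) ∧
    ∀ f, ‖U f‖ = ‖f‖ := by
  set s : ℝ := √(1 - ‖a‖ ^ 2) with hs
  have hs2 : (s : ℂ) ^ 2 = 1 - (starRingEnd ℂ) a * a := by
    rw [Complex.conj_mul', ← Complex.ofReal_pow, hs,
      Real.sq_sqrt (by nlinarith [norm_nonneg a])]
    push_cast
    rfl
  have hτ := isAnalyticSelfMap_discInvolution ha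
  set U := weightedComp (isHInfty_szegoKernel ha s) hτ with hU
  have hUe : ∀ (f : HardyTwo) (z : ℂ), ‖z‖ < 1 →
      (U f).eval z = s * szegoKernel a z * f.eval (discInvolution a z) := fun f z hz =>
    weightedComp_eval _ _ f (mem_ball_zero_iff.2 hz)
  refine ⟨s, U, hs2, hUe, ?_⟩
  -- The weights cancel because s² K_a(z) K_a(τ_a z) = s² / (1 - |a|²) = 1.
  have hinv : ∀ f, U (U f) = f := by
    intro f
    refine HardyTwo.ext_eval fun z hz => ?_
    have hne := one_sub_conj_mul_ne_zero ha hz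
    have hna := one_sub_conj_mul_ne_zero ha ha
    rw [hUe _ z hz, hUe _ _ (hτ.norm_lt hz), discInvolution_discInvolution ha hz, szegoKernel,
      szegoKernel, one_sub_conj_mul_discInvolution ha hz]
    field_simp
    rw [hs2]
  choose k hk hki using @HardyTwo.exists_reproducing
  have hkk : ∀ (v w : ℂ) (hv : ‖v‖ < 1) (hw : ‖w‖ < 1),
      inner ℂ (U (k hw)) (k hv) = (inner ℂ (k hw) (U (k hv)) : ℂ) := by
    intro v w hv hw
    rw [← inner_conj_symm, hki, hki, hUe _ _ hv, hUe _ _ hw, hk _ _ (hτ.norm_lt hv),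
      hk _ _ (hτ.norm_lt hw)]
    rw [mul_assoc, mul_assoc, szegoKernel_mul_szegoKernel_discInvolution ha hv,
      szegoKernel_mul_szegoKernel_discInvolution ha hw]
    simp only [map_mul, map_div₀, map_sub, map_one, Complex.conj_conj, Complex.conj_ofReal]
    ring_nf
  -- Symmetry on kernels passes to all of H², since pairing with kernels gives the point values.
  -- Then U*U = U² = 1, so U is isometric.
  have hadj : ∀ f, ContinuousLinearMap.adjoint U f = U f := by
    have hK : ∀ (w : ℂ) (hw : ‖w‖ < 1), ContinuousLinearMap.adjoint U (k hw) = U (k hw) := by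
      intro w hw
      refine HardyTwo.ext_eval fun v hv => ?_
      rw [← hki hv, ← hki hv, ContinuousLinearMap.adjoint_inner_right, hkk]
    intro f
    refine HardyTwo.ext_eval fun w hw => ?_
    rw [← hki hw, ← hki hw, ContinuousLinearMap.adjoint_inner_right, ← hK,
      ContinuousLinearMap.adjoint_inner_left]
  intro f
  have h : inner ℂ (U f) (U f) = (inner ℂ f f : ℂ) := by
    rw [← ContinuousLinearMap.adjoint_inner_right, hadj, hinv]
  rw [inner_self_eq_norm_sq_to_K, inner_self_eq_norm_sq_to_K] at h
  norm_cast at h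
  exact (pow_left_inj₀ (norm_nonneg _) (norm_nonneg _) two_ne_zero).1 h

/-- The prescribed weight is exactly the one for which W is ψ(a) times a unitary conjugate of an
unweighted composition operator whose symbol fixes 0. -/
theorem norm_weightedComp_le {ψ φ : ℂ → ℂ} {a : ℂ} (ha : ‖a‖ < 1) (hψ : IsHInfty ψ)
    (hφ : IsAnalyticSelfMap φ) (hfix : φ a = a)
    (h : ∀ z : ℂ, ‖z‖ < 1 → ψ z = ψ a * (szegoKernel a z / szegoKernel a (φ z))) :
    ‖weightedComp hψ hφ‖ ≤ ‖ψ a‖ := by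
  obtain ⟨s, U, hs, hU, hUn⟩ := exists_isometric_involution ha
  have hτ := isAnalyticSelfMap_discInvolution ha
  refine ContinuousLinearMap.opNorm_le_bound _ (norm_nonneg _) fun f => ?_
  -- The constant (1 - ‖χ 0‖)⁻¹ of `exists_comp`, for the conjugated symbol χ, is 1 because χ fixes
  -- 0.
  obtain ⟨g, hg, hgn⟩ := HardyTwo.exists_comp (hτ.comp (hφ.comp hτ)) (U f)
  have h0 : (discInvolution a ∘ φ ∘ discInvolution a) 0 = 0 := by
    simp [discInvolution, hfix]
  rw [h0, norm_zero, sub_zero, inv_one, one_mul, hUn] at hgn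
  have hW : weightedComp hψ hφ f = ψ a • U g := by
    refine HardyTwo.ext_eval fun z hz => ?_
    have hz' := hφ.norm_lt hz
    have hne := one_sub_conj_mul_ne_zero ha hz
    have hne' := one_sub_conj_mul_ne_zero ha hz'
    have hna := one_sub_conj_mul_ne_zero ha ha
    rw [weightedComp_eval hψ hφ f (mem_ball_zero_iff.2 hz), HardyTwo.eval_smul _ _ hz, hU _ z hz,
      hg _ (hτ.norm_lt hz), Function.comp_apply, Function.comp_apply,
      discInvolution_discInvolution ha hz, hU _ _ (hτ.norm_lt hz'),
      discInvolution_discInvolution ha hz', h z hz, szegoKernel, szegoKernel, szegoKernel,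
      one_sub_conj_mul_discInvolution ha hz', ← hs]
    have hs0 : (s : ℂ) ≠ 0 := by
      intro hs0
      rw [← hs, hs0] at hna
      simp at hna
    field_simp
  rw [hW, norm_smul, hUn]
  gcongr

/-! ### Spectral radius and normaloid criterion -/

theorem mainTheorem6 {φ ψ : ℂ → ℂ} {a : ℂ} (hφ : IsAnalyticSelfMap φ) (hψ : IsHInfty ψ)
    (ha : a ∈ Metric.ball (0 : ℂ) 1) (hDW : IsDenjoyWolffPoint φ a)
    (hpc : IsPowerCompact (weightedComp hψ hφ)) :
    spectralRadius ℂ (weightedComp hψ hφ) = ENNReal.ofReal ‖ψ a‖ ∧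
      (IsNormaloid (weightedComp hψ hφ) ↔
        ∀ z ∈ Metric.ball (0 : ℂ) 1, ψ z = ψ a * (szegoKernel a z / szegoKernel a (φ z))) := by
  have hfix := hDW.map_eq hφ ha
  have hrad := spectralRadius_weightedComp hψ hφ (mem_ball_zero_iff.1 ha) hDW hpc
  refine ⟨hrad, ?_⟩
  rw [IsNormaloid, hrad, ENNReal.ofReal_eq_ofReal_iff (norm_nonneg _) (norm_nonneg _)]
  simp only [mem_ball_zero_iff] at ha ⊢
  refine ⟨fun h z hz => eq_of_norm_weightedComp_le hψ hφ ha hfix h.le hz, fun h => ?_⟩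
  refine le_antisymm (norm_weightedComp_le ha hψ hφ hfix h) ?_
  -- The reverse bound ‖ψ a‖ ≤ ‖W‖ holds because ψ(a) is a spectral value.
  exact (spectrum.norm_le_norm_mul_of_mem (apply_mem_spectrum_weightedComp hψ hφ ha hfix)).trans
    (mul_le_of_le_one_right (norm_nonneg _) ContinuousLinearMap.norm_id_le)
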